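/- \textbf{Theorem (Recovery of eigenvectors from Newton linearizations).} Let $k\ge 1$, $0\le\mu\le k-1$ and $n\ge 1$ be integers, let $x_1,\dots,x_k\in\mathbb C$ be nodes, and put $\gamma_j(\lambda)=\lambda-x_j$, $n_0(\lambda)=1$ and $n_i(\lambda)=\prod_{j=1}^{i}\gamma_j(\lambda)$. Let $P(\lambda)=\sum_{i=0}^k P_i\,n_i(\lambda)$ with $P_0,\dots,P_k\in\mathbb C^{n\times n}$ be regular (that is, $\det P(\lambda)\not\equiv 0$), considered as a matrix polynomial of grade $k$. Let $K_1(\lambda)$ be the block bidiagonal pencil with $k-\mu-1$ block rows and $k-\mu$ block columns having $-I_n$ on the block diagonal and $\gamma_{k-1}(\lambda)I_n,\gamma_{k-2}(\lambda)I_n,\dots,\gamma_{\mu+1}(\lambda)I_n$ on the block superdiagonal. Let $K_2(\lambda)$ be the one with $\mu$ block rows and $\mu+1$ block columns having $-I_n$ on the block diagonal and $\gamma_{\mu}(\lambda)I_n,\dots,\gamma_{1}(\lambda)I_n$ on the block superdiagonal. Let $M(\lambda)$ be the $(\mu+1)\times(k-\mu)$ block matrix whose first block row is $[\,\gamma_k(\lambda)P_k+P_{k-1},\;P_{k-2},\;\dots,\;P_{\mu}\,]$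 (a single block $\gamma_k(\lambda)P_k+P_{k-1}$ if $\mu=k-1$), whose last block column has the blocks $P_{\mu-1},\dots,P_1,P_0$ below its first block, and whose other blocks are zero. For arbitrary matrices $A\in\mathbb C^{(\mu+1)n\times(k-\mu-1)n}$ and $B\in\mathbb C^{\mu n\times(k-\mu)n}$, let \[ N(\lambda)=\begin{bmatrix} M(\lambda)+A\,K_1(\lambda)+K_2(\lambda)^T B & K_2(\lambda)^T\\ K_1(\lambda) & 0\end{bmatrix} \] be the corresponding Newton linearization of $P$. A right (left) eigenvector of a square matrix polynomial $Q$ of grade $d$ for $\lambda_0\in\mathbb C$ is a vector $v\ne 0$ with $Q(\lambda_0)v=0$ (resp. $v^TQ(\lambda_0)=0$). For $\lambda_0=\infty$ it is a right (left) eigenvector of the reversal $\lambda^dQ(1/\lambda)$ for the value $0$. Here $P$ has grade $k$ and $N$ has grade $1$. Let $\lambda_0\in\mathbb C\cup\{\infty\}$ be an eigenvalue of $P$, and let $z$ and $\omega$ be a right and a left eigenvector of $N$ associated with $\lambda_0$, regarded as block vectors with $k$ blocks $z(1),\dots,z(k)$ and $\omega(1),\dots,\omega(k)$ of length $n$. \begin{enumerate}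 \item Suppose $\lambda_0$ is finite. Then $z(k-\mu)$ is a right eigenvector of $P$ associated with $\lambda_0$. If, in addition, $\lambda_0\notin\{x_{\mu+1},\dots,x_{k-1}\}$, then $z(1),\dots,z(k-\mu)$ are all right eigenvectors of $P$ associated with $\lambda_0$. Moreover, $\omega(\mu+1)$ is a left eigenvector of $P$ associated with $\lambda_0$. If, in addition, $\lambda_0\notin\{x_1,\dots,x_\mu\}$, then $\omega(1),\dots,\omega(\mu+1)$ are all left eigenvectors of $P$ associated with $\lambda_0$. \item Suppose $\lambda_0=\infty$. Then $z(1)$ is a right eigenvector and $\omega(1)$ a left eigenvector of $P$ associated with $\infty$. \end{enumerate} -/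

import Mathlib

open Polynomial

namespace NewtonLin

noncomputable section

/-! ### Matrix polynomials, reversals, eigenvalues and eigenvectors -/

/-- A square matrix polynomial is regular if its determinant is not identically zero. -/
def IsRegular {ι : Type*} [Fintype ι] [DecidableEq ι] (P : Matrix ι ι ℂ[X]) : Prop :=
  P.det ≠ 0

/-- The `d`-reversal `t ^ d * P (1 / t)` of a matrix polynomial `P` of grade `d`
(every entry has degree at most `d`): entrywise, the coefficient of `t ^ i` becomes the
coefficient of `t ^ (d - i)`. -/
def rev {ι κ : Type*} (d : ℕ) (P : Matrix ι κ ℂ[X]) : Matrix ι κ ℂ[X] :=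
  P.map (Polynomial.reflect d)

/-- `v` is a right eigenvector of `P` for the finite value `c`: `v ≠ 0` and `P(c) v = 0`. -/
def IsFiniteRightEigenvector {ι κ : Type*} [Fintype κ]
    (P : Matrix ι κ ℂ[X]) (c : ℂ) (v : κ → ℂ) : Prop :=
  v ≠ 0 ∧ (P.map (Polynomial.eval c)).mulVec v = 0

/-- `w` is a left eigenvector of `P` for the finite value `c`: `w ≠ 0` and `wᵀ P(c) = 0`. -/
def IsFiniteLeftEigenvector {ι κ : Type*} [Fintype ι]
    (P : Matrix ι κ ℂ[X]) (c : ℂ) (w : ι → ℂ) : Prop :=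
  w ≠ 0 ∧ Matrix.vecMul w (P.map (Polynomial.eval c)) = 0

/-- Right eigenvectors of a matrix polynomial of grade `d`, for a value in `ℂ ∪ {∞}`.
Those for `∞` are the right eigenvectors of the `d`-reversal for the value `0`. -/
def IsRightEigenvector {ι κ : Type*} [Fintype κ] (d : ℕ) (P : Matrix ι κ ℂ[X]) :
    OnePoint ℂ → (κ → ℂ) → Prop
  | OnePoint.some c, v => IsFiniteRightEigenvector P c v
  | OnePoint.infty, v => IsFiniteRightEigenvector (rev d P) 0 v

/-- Left eigenvectors of a matrix polynomial of grade `d`, for a value in `ℂ ∪ {∞}`.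
Those for `∞` are the left eigenvectors of the `d`-reversal for the value `0`. -/
def IsLeftEigenvector {ι κ : Type*} [Fintype ι] (d : ℕ) (P : Matrix ι κ ℂ[X]) :
    OnePoint ℂ → (ι → ℂ) → Prop
  | OnePoint.some c, w => IsFiniteLeftEigenvector P c w
  | OnePoint.infty, w => IsFiniteLeftEigenvector (rev d P) 0 w

/-- Eigenvalues, finite or infinite, of a (regular) matrix polynomial of grade `d`. -/
def IsEigenvalue {ι : Type*} [Fintype ι] (d : ℕ) (P : Matrix ι ι ℂ[X])
    (lam : OnePoint ℂ) : Prop :=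
  ∃ v, IsRightEigenvector d P lam v

/-! ### The Newton basis

Nodes `x 1, …, x k` and coefficients `P 0, …, P k` are given as sequences indexed by `ℕ`;
the definitions below use no other entries of them. -/

/-- `γ_j = X - x_j`. -/
def gam (x : ℕ → ℂ) (j : ℕ) : ℂ[X] := X - C (x j)

/-- The Newton polynomial `n_i = ∏_{j=1}^i (X - x_j)`. -/
def newtonPoly (x : ℕ → ℂ) (i : ℕ) : ℂ[X] := ∏ j ∈ Finset.Icc 1 i, gam x j

/-- The matrix polynomial `∑_{i=0}^k P_i n_i`. -/
def newtonMatPoly {m n : ℕ} (k : ℕ) (x : ℕ → ℂ) (P : ℕ → Matrix (Fin m) (Fin n) ℂ) :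
    Matrix (Fin m) (Fin n) ℂ[X] :=
  ∑ i ∈ Finset.range (k + 1), newtonPoly x i • (P i).map C

/-! ### Newton linearizations

Block rows and block columns are numbered from `0` here. -/

/-- `K₁`, with `k-μ-1` block rows and `k-μ` block columns: `-I_n` on the block diagonal,
and `γ_{k-1} I_n, γ_{k-2} I_n, …, γ_{μ+1} I_n` on the block superdiagonal. -/
def K1 (n k μ : ℕ) (x : ℕ → ℂ) :
    Matrix (Fin (k - μ - 1) × Fin n) (Fin (k - μ) × Fin n) ℂ[X] :=
  Matrix.comp _ _ _ _ _ (Matrix.of fun r c =>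
    if (c : ℕ) = r then (-1 : Matrix (Fin n) (Fin n) ℂ[X])
    else if (c : ℕ) = r + 1 then gam x (k - 1 - r) • (1 : Matrix (Fin n) (Fin n) ℂ[X])
    else 0)

/-- `K₂`, with `μ` block rows and `μ+1` block columns: `-I_m` on the block diagonal,
and `γ_μ I_m, γ_{μ-1} I_m, …, γ_1 I_m` on the block superdiagonal. -/
def K2 (m μ : ℕ) (x : ℕ → ℂ) :
    Matrix (Fin μ × Fin m) (Fin (μ + 1) × Fin m) ℂ[X] :=
  Matrix.comp _ _ _ _ _ (Matrix.of fun r c =>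
    if (c : ℕ) = r then (-1 : Matrix (Fin m) (Fin m) ℂ[X])
    else if (c : ℕ) = r + 1 then gam x (μ - r) • (1 : Matrix (Fin m) (Fin m) ℂ[X])
    else 0)

/-- The body `M_μ` of the colleague pencil, with `μ+1` block rows and `k-μ` block columns:
the first block row is `γ_k P_k + P_{k-1}, P_{k-2}, …, P_{μ+1}, P_μ`, the last block column is
completed below its first block by `P_{μ-1}, …, P_1, P_0`, and all other blocks are zero.
If `μ = k - 1` there is one block column, whose first block is `γ_k P_k + P_{k-1}`. -/
def body {m n : ℕ} (k μ : ℕ) (x : ℕ → ℂ) (P : ℕ → Matrix (Fin m) (Fin n) ℂ) :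
    Matrix (Fin (μ + 1) × Fin m) (Fin (k - μ) × Fin n) ℂ[X] :=
  Matrix.comp _ _ _ _ _ (Matrix.of fun r c =>
    if (r : ℕ) = 0 then
      if (c : ℕ) = 0 then gam x k • (P k).map C + (P (k - 1)).map C
      else (P (k - 1 - c)).map C
    else if (c : ℕ) = k - μ - 1 then (P (μ - r)).map C
    else 0)

/-- The Newton linearization
`[ M_μ + A K₁ + K₂ᵀ B , K₂ᵀ ; K₁ , 0 ]` of `∑ P_i n_i` given by constant matrices `A`, `B`. -/
def newtonLinearization {m n : ℕ} (k μ : ℕ) (x : ℕ → ℂ) (P : ℕ → Matrix (Fin m) (Fin n) ℂ)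
    (A : Matrix (Fin (μ + 1) × Fin m) (Fin (k - μ - 1) × Fin n) ℂ)
    (B : Matrix (Fin μ × Fin m) (Fin (k - μ) × Fin n) ℂ) :
    Matrix ((Fin (μ + 1) × Fin m) ⊕ (Fin (k - μ - 1) × Fin n))
      ((Fin (k - μ) × Fin n) ⊕ (Fin μ × Fin m)) ℂ[X] :=
  Matrix.fromBlocks
    (body k μ x P + A.map C * K1 n k μ x + (K2 m μ x).transpose * B.map C)
    (K2 m μ x).transpose
    (K1 n k μ x)
    0

/-- For a block vector with `a + b` blocks of length `n`, the block entry at (zero-based)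
position `i < a`, that is, the `(i+1)`-st block. -/
def block {a b n : ℕ} (v : (Fin a × Fin n) ⊕ (Fin b × Fin n) → ℂ) (i : Fin a) : Fin n → ℂ :=
  fun j => v (Sum.inl (i, j))

end

end NewtonLin

/-! Apply one linear functional `φ` to every entry: evaluation at `c` for a finite eigenvalue, or
the top-grade coefficient for infinity, since a reversal at `0` is that coefficient. The pencil
becomes a constant matrix `[M + A L₁ + L₂ᵀ B, L₂ᵀ; L₁, 0]`. For a right null vector with upper part
`u`, the lower row says `L₁ u = 0`, and pairing the upper row with any `v` in the kernel of `L₂`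
removes `A` and `B`, leaving `vᵀ M u = 0` (`fromBlocks_mulVec_eq_zero`).

Both kernels are explicit: a single free vector of length `n`, scaled blockwise by Newton-type
products (finite case) or placed in the first block (infinity). With these weights the blocks of `M`
add up to `φ(P)` (`sum_body_eval`, `sum_body_coeff`), so `bᵀ φ(P) a = 0` for every `b`, where `a` is
the free block of `u`. Injectivity of `L₂ᵀ` ensures `a ≠ 0`. Left eigenvectors follow by
transposition, which exchanges `L₁` and `L₂`. -/

namespace NewtonLin

open Matrix

/-! ### Kernels of block bidiagonal matrices -/

/-- The complex block bidiagonal matrix with blocks `-a I` on the diagonal and `g r I` on the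
superdiagonal. -/
def bidiag (n p q : ℕ) (a : ℂ) (g : ℕ → ℂ) : Matrix (Fin p × Fin n) (Fin q × Fin n) ℂ :=
  Matrix.of fun r c => if r.2 = c.2 then
    (if (c.1 : ℕ) = r.1 then -a else if (c.1 : ℕ) = r.1 + 1 then g r.1 else 0) else 0

lemma bidiag_mulVec {n p q : ℕ} (hq : q = p + 1) (a : ℂ) (g : ℕ → ℂ)
    (u : Fin q × Fin n → ℂ) (r : Fin p) (i : Fin n) :
    (bidiag n p q a g *ᵥ u) (r, i) =
      -a * u (⟨r, by omega⟩, i) + g r * u (⟨r + 1, by omega⟩, i) := by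
  subst hq
  have hne : ((⟨r, by omega⟩, i) : Fin (p + 1) × Fin n) ≠ (⟨r + 1, by omega⟩, i) := by
    simp
  rw [Matrix.mulVec, dotProduct, ← Finset.sum_subset (Finset.subset_univ
    {((⟨r, by omega⟩, i) : Fin (p + 1) × Fin n), (⟨r + 1, by omega⟩, i)}), Finset.sum_pair hne]
  · simp [bidiag]
  · rintro ⟨c, j⟩ - hc
    simp only [Finset.mem_insert, Finset.mem_singleton, Prod.mk.injEq, Fin.ext_iff, not_or,
      not_and] at hc
    simp only [bidiag, Matrix.of_apply, Fin.ext_iff]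
    split_ifs with h1 h2 h3
    · exact absurd h1.symm (hc.1 h2)
    · exact absurd h1.symm (hc.2 h3)
    · simp
    · simp

/-- Forward substitution: the first `p` block rows of the transpose are lower triangular with `-I`
on the diagonal. -/
lemma eq_zero_of_bidiag_one_transpose {n p q : ℕ} (hq : q = p + 1) (g : ℕ → ℂ)
    (y : Fin p × Fin n → ℂ) (h : (bidiag n p q 1 g)ᵀ *ᵥ y = 0) : y = 0 := by
  have key : ∀ r : ℕ, ∀ hr : r < p, ∀ i, y (⟨r, hr⟩, i) = 0 := by
    intro r
    induction r using Nat.strong_induction_on with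
    | _ r ih =>
      intro hr i
      have := congrFun h (⟨r, by omega⟩, i)
      rw [Matrix.mulVec, dotProduct, Finset.sum_eq_single (⟨r, hr⟩, i)] at this
      · simpa [bidiag] using this
      · rintro ⟨c, j⟩ - hc
        by_cases hcr : (c : ℕ) < r
        · rw [ih c hcr c.2 j, mul_zero]
        · have : ¬ (j = i ∧ r = c) := by
            rintro ⟨rfl, h2⟩
            exact hc (by simp [h2])
          simp only [bidiag, Matrix.transpose_apply, Matrix.of_apply]
          split_ifs with h1 h2 h3
          · exact absurd ⟨h1, h2⟩ this
          · omega
          · simp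
          · simp
      · simp
  ext ⟨r, i⟩
  exact key r r.2 i

lemma eq_zero_of_bidiag_zero_transpose {n p q : ℕ} (hq : q = p + 1)
    (y : Fin p × Fin n → ℂ) (h : (bidiag n p q 0 (fun _ => 1))ᵀ *ᵥ y = 0) : y = 0 := by
  ext ⟨r, i⟩
  have := congrFun h (⟨r + 1, by omega⟩, i)
  rw [Matrix.mulVec, dotProduct, Finset.sum_eq_single (r, i)] at this
  · simpa [bidiag] using this
  · rintro ⟨c, j⟩ - hc
    simp only [bidiag, Matrix.transpose_apply, Matrix.of_apply, neg_zero]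
    split_ifs with h1 h2 h3
    · simp
    · exact absurd (Prod.ext (Fin.ext (by simpa using h3.symm)) h1) hc
    · simp
    · simp
  · simp

lemma bidiag_one_mulVec_eq_zero {n p q : ℕ} (hq : q = p + 1) {g G : ℕ → ℂ}
    (hG : ∀ r < p, G r = g r * G (r + 1)) (b : Fin n → ℂ) :
    bidiag n p q 1 g *ᵥ (fun r => G r.1 * b r.2) = 0 := by
  ext ⟨r, i⟩
  rw [bidiag_mulVec hq, hG r r.2]
  simp only [Pi.zero_apply]
  ring

lemma bidiag_zero_mulVec_eq_zero {n p q : ℕ} (hq : q = p + 1) (b : Fin n → ℂ) :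
    bidiag n p q 0 (fun _ => 1) *ᵥ
      (fun r => (if (r.1 : ℕ) = 0 then 1 else 0) * b r.2) = 0 := by
  ext ⟨r, i⟩
  rw [bidiag_mulVec hq]
  simp

/-- Back substitution from the last block, which is free; `G` solves the same recurrence, normalized
to `1` there. -/
lemma eq_of_bidiag_one_mulVec {n p q : ℕ} (hq : q = p + 1) {g G : ℕ → ℂ}
    (hG : ∀ r < p, G r = g r * G (r + 1)) (hp : G p = 1) {u : Fin q × Fin n → ℂ}
    (h : bidiag n p q 1 g *ᵥ u = 0) : u = fun r => G r.1 * u (⟨p, by omega⟩, r.2) := by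
  have key : ∀ d r : ℕ, ∀ hr : r + d = p, ∀ i,
      u (⟨r, by omega⟩, i) = G r * u (⟨p, by omega⟩, i) := by
    intro d
    induction d with
    | zero =>
      intro r hr i
      obtain rfl : r = p := by omega
      rw [hp, one_mul]
    | succ d ih =>
      intro r hr i
      have h1 := congrFun h (⟨r, by omega⟩, i)
      rw [bidiag_mulVec hq] at h1
      have h2 := ih (r + 1) (by omega) i
      simp only [Pi.zero_apply] at h1
      rw [hG r (by omega)]
      linear_combination -h1 + g r * h2
  ext ⟨r, i⟩
  exact key (p - r) r (by omega) i

/-- Without the diagonal the matrix is a block shift, so every block except the first must vanish.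
-/
lemma eq_of_bidiag_zero_mulVec {n p q : ℕ} (hq : q = p + 1) {u : Fin q × Fin n → ℂ}
    (h : bidiag n p q 0 (fun _ => 1) *ᵥ u = 0) :
    u = fun r => (if (r.1 : ℕ) = 0 then 1 else 0) * u (⟨0, by omega⟩, r.2) := by
  ext ⟨⟨r, hr⟩, i⟩
  cases r with
  | zero => simp
  | succ r =>
    have h1 := congrFun h (⟨r, by omega⟩, i)
    rw [bidiag_mulVec hq] at h1
    simpa using h1

/-! ### Null vectors of the bordered block matrix -/

lemma fromBlocks_mulVec_eq_zero {ι₁ ι₂ κ₁ κ₂ : Type*} [Fintype ι₁] [Fintype ι₂] [Fintype κ₁]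
    [Fintype κ₂] {M : Matrix ι₁ κ₁ ℂ} {A : Matrix ι₁ ι₂ ℂ} {B : Matrix κ₂ κ₁ ℂ}
    {L₁ : Matrix ι₂ κ₁ ℂ} {L₂ : Matrix κ₂ ι₁ ℂ} (hinj : ∀ y, L₂ᵀ *ᵥ y = 0 → y = 0)
    {z : κ₁ ⊕ κ₂ → ℂ} (hz : z ≠ 0)
    (h : fromBlocks (M + A * L₁ + L₂ᵀ * B) L₂ᵀ L₁ 0 *ᵥ z = 0) :
    L₁ *ᵥ (z ∘ Sum.inl) = 0 ∧ z ∘ Sum.inl ≠ 0 ∧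
      ∀ v, L₂ *ᵥ v = 0 → v ⬝ᵥ (M *ᵥ (z ∘ Sum.inl)) = 0 := by
  rw [fromBlocks_mulVec] at h
  have h1 : L₁ *ᵥ (z ∘ Sum.inl) = 0 := by
    ext i
    simpa using congrFun h (Sum.inr i)
  have h2 : M *ᵥ (z ∘ Sum.inl) + L₂ᵀ *ᵥ (B *ᵥ (z ∘ Sum.inl) + z ∘ Sum.inr) = 0 := by
    ext i
    have := congrFun h (Sum.inl i)
    simp only [Sum.elim_inl, add_mulVec, ← mulVec_mulVec, h1, mulVec_zero, add_zero] at this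
    rw [mulVec_add, ← add_assoc]
    exact this
  refine ⟨h1, fun h0 => hz ?_, fun v hv => ?_⟩
  · rw [h0, mulVec_zero, mulVec_zero, zero_add, zero_add] at h2
    have h3 := hinj _ h2
    ext (i | i)
    · exact congrFun h0 i
    · exact congrFun h3 i
  · have h3 := congrArg (fun t => v ⬝ᵥ t) h2
    simp only [dotProduct_add, dotProduct_zero] at h3
    rwa [dotProduct_mulVec v L₂ᵀ, vecMul_transpose, hv, zero_dotProduct, add_zero] at h3

/-- The transposed matrix has the same shape, with `L₁` and `L₂` exchanged and `Bᵀ`, `Aᵀ` in place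
of `A`, `B`. -/
lemma vecMul_fromBlocks_eq_zero {ι₁ ι₂ κ₁ κ₂ : Type*} [Fintype ι₁] [Fintype ι₂] [Fintype κ₁]
    [Fintype κ₂] {M : Matrix ι₁ κ₁ ℂ} {A : Matrix ι₁ ι₂ ℂ} {B : Matrix κ₂ κ₁ ℂ}
    {L₁ : Matrix ι₂ κ₁ ℂ} {L₂ : Matrix κ₂ ι₁ ℂ} (hinj : ∀ y, L₁ᵀ *ᵥ y = 0 → y = 0)
    {w : ι₁ ⊕ ι₂ → ℂ} (hw : w ≠ 0)
    (h : w ᵥ* fromBlocks (M + A * L₁ + L₂ᵀ * B) L₂ᵀ L₁ 0 = 0) :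
    L₂ *ᵥ (w ∘ Sum.inl) = 0 ∧ w ∘ Sum.inl ≠ 0 ∧
      ∀ v, L₁ *ᵥ v = 0 → (w ∘ Sum.inl) ⬝ᵥ (M *ᵥ v) = 0 := by
  have h' : fromBlocks (Mᵀ + Bᵀ * L₂ + L₁ᵀ * Aᵀ) L₁ᵀ L₂ 0 *ᵥ w = 0 := by
    rw [← mulVec_transpose, fromBlocks_transpose] at h
    simp only [transpose_add, transpose_mul, transpose_transpose, transpose_zero] at h
    rwa [add_right_comm] at h
  obtain ⟨h1, h2, h3⟩ := fromBlocks_mulVec_eq_zero hinj hw h'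
  refine ⟨h1, h2, fun v hv => ?_⟩
  rw [dotProduct_mulVec, dotProduct_comm, ← mulVec_transpose]
  exact h3 v hv

/-! ### Collapsing the body to an `n × n` matrix -/

lemma dotProduct_mulVec_scaled {n p q : ℕ} (M : Matrix (Fin p × Fin n) (Fin q × Fin n) ℂ)
    (S : Matrix (Fin n) (Fin n) ℂ) (F G : ℕ → ℂ)
    (hS : ∀ i j, ∑ r : Fin p, ∑ c : Fin q, F r * G c * M (r, i) (c, j) = S i j)
    (b a : Fin n → ℂ) :
    (fun r : Fin p × Fin n => F r.1 * b r.2) ⬝ᵥ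
      (M *ᵥ (fun c : Fin q × Fin n => G c.1 * a c.2)) = b ⬝ᵥ (S *ᵥ a) := by
  simp only [dotProduct, Matrix.mulVec, Fintype.sum_prod_type, ← hS, Finset.mul_sum,
    Finset.sum_mul]
  rw [Finset.sum_comm]
  refine Finset.sum_congr rfl fun i _ => ?_
  rw [Finset.sum_comm' (t' := Finset.univ) (s' := fun _ => Finset.univ) (by simp)]
  conv_rhs => rw [Finset.sum_comm]
  conv_lhs => rw [Finset.sum_comm]
  refine Finset.sum_congr rfl fun r _ => ?_
  rw [Finset.sum_comm]
  refine Finset.sum_congr rfl fun j _ => Finset.sum_congr rfl fun c _ => ?_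
  ring

/-- The blocks of the evaluated body, weighted by Newton products, add up to the Newton sum. -/
lemma sum_body_coeffs (μ a : ℕ) (y p : ℕ → ℂ) :
    ∑ r ∈ Finset.range (μ + 1), ∑ c ∈ Finset.range (a + 1),
      (∏ j ∈ Finset.Icc 1 (μ - r), y j) * (∏ j ∈ Finset.Icc (μ + 1) (μ + a - c), y j) *
        (if r = 0 then
          if c = 0 then y (μ + a + 1) * p (μ + a + 1) + p (μ + a) else p (μ + a - c)
        else if c = a then p (μ - r) else 0) =
    ∑ i ∈ Finset.range (μ + a + 1 + 1), (∏ j ∈ Finset.Icc 1 i, y j) * p i := by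
  -- In the first block row the two weights combine into one Newton product.
  have hn : ∀ s, (∏ j ∈ Finset.Icc 1 μ, y j) * (∏ j ∈ Finset.Icc (μ + 1) (μ + s), y j) =
      ∏ j ∈ Finset.Icc 1 (μ + s), y j := by
    intro s
    induction s with
    | zero => simp
    | succ s ih =>
      rw [← add_assoc, Finset.prod_Icc_succ_top (by omega), Finset.prod_Icc_succ_top (by omega),
        ← ih, mul_assoc]
  -- With `k = μ + a + 1`, the first block row supplies the terms of index `μ` to `k`.
  have h0 : ∑ c ∈ Finset.range (a + 1),
      (∏ j ∈ Finset.Icc 1 μ, y j) * (∏ j ∈ Finset.Icc (μ + 1) (μ + a - c), y j) *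
        (if c = 0 then y (μ + a + 1) * p (μ + a + 1) + p (μ + a) else p (μ + a - c)) =
      (∏ j ∈ Finset.Icc 1 (μ + a + 1), y j) * p (μ + a + 1) +
      ∑ c ∈ Finset.range (a + 1), (∏ j ∈ Finset.Icc 1 (μ + c), y j) * p (μ + c) := by
    rw [← Finset.sum_range_reflect (fun c => (∏ j ∈ Finset.Icc 1 (μ + c), y j) * p (μ + c)),
      Finset.sum_range_succ', Finset.sum_range_succ', Finset.prod_Icc_succ_top (by omega)]
    have : ∀ c ∈ Finset.range a,
        (∏ j ∈ Finset.Icc 1 μ, y j) * (∏ j ∈ Finset.Icc (μ + 1) (μ + a - (c + 1)), y j) *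
        (if c + 1 = 0 then y (μ + a + 1) * p (μ + a + 1) + p (μ + a) else p (μ + a - (c + 1))) =
        (∏ j ∈ Finset.Icc 1 (μ + (a + 1 - 1 - (c + 1))), y j) *
          p (μ + (a + 1 - 1 - (c + 1))) := by
      intro c hc
      rw [Finset.mem_range] at hc
      have e : μ + a - (c + 1) = μ + (a + 1 - 1 - (c + 1)) := by omega
      rw [e, hn, if_neg (by omega)]
    rw [Finset.sum_congr rfl this]
    simp only [Nat.sub_zero, if_true, hn, Nat.add_sub_cancel]
    ring
  -- Below it only the last column survives, where the second weight is an empty product; this gives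
  -- the indices below `μ`.
  have h1 : ∀ r ∈ Finset.range μ, ∑ c ∈ Finset.range (a + 1),
      (∏ j ∈ Finset.Icc 1 (μ - (r + 1)), y j) *
        (∏ j ∈ Finset.Icc (μ + 1) (μ + a - c), y j) *
        (if r + 1 = 0 then
          if c = 0 then y (μ + a + 1) * p (μ + a + 1) + p (μ + a) else p (μ + a - c)
        else if c = a then p (μ - (r + 1)) else 0) =
      (∏ j ∈ Finset.Icc 1 (μ - 1 - r), y j) * p (μ - 1 - r) := by
    intro r hr
    rw [Finset.sum_eq_single a]
    · have e : μ - (r + 1) = μ - 1 - r := by omega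
      simp [e]
    · intro c _ hc
      simp [hc]
    · simp
  rw [Finset.sum_range_succ', Finset.sum_congr rfl h1,
    Finset.sum_range_reflect (fun r => (∏ j ∈ Finset.Icc 1 r, y j) * p r)]
  simp only [Nat.sub_zero, if_true]
  rw [h0, Finset.sum_range_succ _ (μ + a + 1), add_assoc μ a 1, Finset.sum_range_add _ μ (a + 1)]
  ring

/-! ### Linear functionals applied entrywise -/

lemma map_newtonMatPoly {n : ℕ} (k : ℕ) (x : ℕ → ℂ) (P : ℕ → Matrix (Fin n) (Fin n) ℂ)
    (φ : ℂ[X] →ₗ[ℂ] ℂ) (i j : Fin n) :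
    φ (newtonMatPoly k x P i j) =
      ∑ l ∈ Finset.range (k + 1), φ (newtonPoly x l) * P l i j := by
  simp only [newtonMatPoly, Matrix.sum_apply, map_sum]
  refine Finset.sum_congr rfl fun l _ => ?_
  rw [Matrix.smul_apply, Matrix.map_apply, smul_eq_mul, mul_comm, ← smul_eq_C_mul, map_smul,
    smul_eq_mul, mul_comm]

lemma map_K1 (n k μ : ℕ) (x : ℕ → ℂ) (φ : ℂ[X] →ₗ[ℂ] ℂ) :
    (K1 n k μ x).map φ =
      bidiag n (k - μ - 1) (k - μ) (φ 1) (fun r => φ (gam x (k - 1 - r))) := by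
  ext ⟨r, i⟩ ⟨c, j⟩
  simp only [K1, bidiag, Matrix.map_apply, Matrix.comp_apply, Matrix.of_apply]
  split_ifs <;> simp_all

lemma map_K2 (n μ : ℕ) (x : ℕ → ℂ) (φ : ℂ[X] →ₗ[ℂ] ℂ) :
    (K2 n μ x).map φ = bidiag n μ (μ + 1) (φ 1) (fun r => φ (gam x (μ - r))) := by
  ext ⟨r, i⟩ ⟨c, j⟩
  simp only [K2, bidiag, Matrix.map_apply, Matrix.comp_apply, Matrix.of_apply]
  split_ifs <;> simp_all

/-- Since `A` and `B` are constant, linearity of `φ` suffices; multiplicativity, which coefficient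
functionals lack, is not needed. -/
lemma map_newtonLinearization {n : ℕ} (k μ : ℕ) (x : ℕ → ℂ)
    (P : ℕ → Matrix (Fin n) (Fin n) ℂ)
    (A : Matrix (Fin (μ + 1) × Fin n) (Fin (k - μ - 1) × Fin n) ℂ)
    (B : Matrix (Fin μ × Fin n) (Fin (k - μ) × Fin n) ℂ) (φ : ℂ[X] →ₗ[ℂ] ℂ) :
    (newtonLinearization k μ x P A B).map φ =
      fromBlocks ((body k μ x P).map φ + A * (K1 n k μ x).map φ + ((K2 n μ x).map φ)ᵀ * B)
        ((K2 n μ x).map φ)ᵀ ((K1 n k μ x).map φ) 0 := by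
  rw [newtonLinearization, fromBlocks_map]
  congr 1
  · ext i j
    simp only [Matrix.map_apply, Matrix.add_apply, Matrix.mul_apply, map_add, map_sum,
      Matrix.transpose_apply]
    congr 1
    · congr 1
      refine Finset.sum_congr rfl fun l _ => ?_
      rw [← smul_eq_C_mul, map_smul, smul_eq_mul]
    · refine Finset.sum_congr rfl fun l _ => ?_
      rw [mul_comm, ← smul_eq_C_mul, map_smul, smul_eq_mul, mul_comm]
  · ext i j
    simp

lemma map_body_apply {n : ℕ} (k μ : ℕ) (x : ℕ → ℂ) (P : ℕ → Matrix (Fin n) (Fin n) ℂ)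
    (φ : ℂ[X] →ₗ[ℂ] ℂ) (r : Fin (μ + 1)) (c : Fin (k - μ)) (i j : Fin n) :
    (body k μ x P).map φ (r, i) (c, j) =
      if (r : ℕ) = 0 then
        if (c : ℕ) = 0 then φ (gam x k) * P k i j + φ 1 * P (k - 1) i j
        else φ 1 * P (k - 1 - c) i j
      else if (c : ℕ) = k - μ - 1 then φ 1 * P (μ - r) i j else 0 := by
  have hC : ∀ t, φ (C t) = φ 1 * t := fun t => by
    rw [← mul_one (C t), ← smul_eq_C_mul, map_smul, smul_eq_mul, mul_comm]
  simp only [body, Matrix.map_apply, Matrix.comp_apply, Matrix.of_apply]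
  split_ifs
  · rw [Matrix.add_apply, map_add, Matrix.map_apply, hC, Matrix.smul_apply, Matrix.map_apply,
      smul_eq_mul, mul_comm, ← smul_eq_C_mul, map_smul, smul_eq_mul, mul_comm]
  · rw [Matrix.map_apply, hC]
  · rw [Matrix.map_apply, hC]
  · simp

lemma newtonPoly_eval (x : ℕ → ℂ) (c : ℂ) (i : ℕ) :
    (newtonPoly x i).eval c = ∏ j ∈ Finset.Icc 1 i, (c - x j) := by
  simp [newtonPoly, gam, eval_prod]

/-- Newton polynomials are monic, `newtonPoly x i` having degree `i`. -/
lemma newtonPoly_coeff {k i : ℕ} (x : ℕ → ℂ) (hi : i ≤ k) :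
    (newtonPoly x i).coeff k = if i = k then 1 else 0 := by
  have hm : (newtonPoly x i).Monic := monic_prod_of_monic _ _ fun j _ => monic_X_sub_C _
  have hd : (newtonPoly x i).natDegree = i := by
    rw [newtonPoly, natDegree_prod_of_monic _ _ fun j _ => monic_X_sub_C _]
    simp [gam]
  split_ifs with h
  · subst h
    conv_lhs => rw [← hd]
    simpa [hd] using hm.coeff_natDegree
  · exact coeff_eq_zero_of_natDegree_lt (by omega)

lemma map_eval_rev {ι κ : Type*} (d : ℕ) (Q : Matrix ι κ ℂ[X]) :
    (rev d Q).map (eval 0) = Q.map (lcoeff ℂ d) := by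
  ext i j
  simp [rev, ← coeff_zero_eq_eval_zero, coeff_reflect, revAt_le]

lemma sum_body_eval {n k μ : ℕ} (hμ : μ < k) (x : ℕ → ℂ) (P : ℕ → Matrix (Fin n) (Fin n) ℂ)
    (c : ℂ) (i j : Fin n) :
    ∑ r : Fin (μ + 1), ∑ s : Fin (k - μ),
      (∏ l ∈ Finset.Icc 1 (μ - r), (c - x l)) *
        (∏ l ∈ Finset.Icc (μ + 1) (k - 1 - s), (c - x l)) *
        (body k μ x P).map (leval c) (r, i) (s, j) =
      (newtonMatPoly k x P).map (leval c) i j := by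
  obtain ⟨a, rfl⟩ := Nat.exists_eq_add_of_lt hμ
  have e := sum_body_coeffs μ a (fun l => c - x l) (fun l => P l i j)
  rw [Matrix.map_apply, map_newtonMatPoly]
  simp only [leval_apply, newtonPoly_eval]
  rw [← e, Finset.sum_range]
  refine Finset.sum_congr rfl fun r _ => ?_
  have ha : μ + a + 1 - μ = a + 1 := by omega
  rw [← ha, Finset.sum_range]
  refine Finset.sum_congr rfl fun s _ => ?_
  rw [map_body_apply]
  have ha' : μ + a + 1 - μ - 1 = a := by omega
  simp only [ha', Nat.add_sub_cancel, leval_apply, gam, eval_sub, eval_X, eval_C, eval_one,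
    one_mul]

/-- The weights select the corner block `γ_k P_k + P_{k-1}`, whose degree-one coefficient is `P_k`,
the degree-`k` coefficient of the Newton sum. -/
lemma sum_body_coeff {n k μ : ℕ} (hμ : μ < k) (x : ℕ → ℂ) (P : ℕ → Matrix (Fin n) (Fin n) ℂ)
    (i j : Fin n) :
    ∑ r : Fin (μ + 1), ∑ s : Fin (k - μ),
      (if (r : ℕ) = 0 then 1 else 0) * (if (s : ℕ) = 0 then 1 else 0) *
        (body k μ x P).map (lcoeff ℂ 1) (r, i) (s, j) =
      (newtonMatPoly k x P).map (lcoeff ℂ k) i j := by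
  rw [Finset.sum_eq_single ⟨0, by omega⟩, Finset.sum_eq_single ⟨0, by omega⟩]
  · rw [map_body_apply, Matrix.map_apply, map_newtonMatPoly, Finset.sum_eq_single k]
    · simp [newtonPoly_coeff, gam, coeff_one]
    · intro l hl hlk
      rw [Finset.mem_range] at hl
      rw [lcoeff_apply, newtonPoly_coeff x (by omega), if_neg hlk, zero_mul]
    · simp
  · intro s _ hs
    rw [if_neg (fun h => hs (Fin.ext h))]
    simp
  · simp
  · intro r _ hr
    rw [if_neg (fun h => hr (Fin.ext h))]
    simp
  · simp

/-! ### Kernels of `K1` and `K2` -/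

lemma prod_Icc_step (y : ℕ → ℂ) {l h r : ℕ} (hr : l + r < h) :
    ∏ j ∈ Finset.Icc (l + 1) (h - r), y j =
      y (h - r) * ∏ j ∈ Finset.Icc (l + 1) (h - (r + 1)), y j := by
  obtain ⟨t, ht⟩ : ∃ t, h - r = t + 1 := ⟨h - r - 1, by omega⟩
  have ht' : h - (r + 1) = t := by omega
  rw [ht, ht', Finset.prod_Icc_succ_top (by omega), mul_comm]

lemma prod_Icc_last (y : ℕ → ℂ) (l h : ℕ) :
    ∏ j ∈ Finset.Icc (l + 1) (h - (h - l)), y j = 1 := by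
  rw [Finset.Icc_eq_empty (by omega), Finset.prod_empty]

variable {n k μ : ℕ} {x : ℕ → ℂ} {P : ℕ → Matrix (Fin n) (Fin n) ℂ}
  {A : Matrix (Fin (μ + 1) × Fin n) (Fin (k - μ - 1) × Fin n) ℂ}
  {B : Matrix (Fin μ × Fin n) (Fin (k - μ) × Fin n) ℂ}

lemma map_K1_eval (n k μ : ℕ) (x : ℕ → ℂ) (c : ℂ) : (K1 n k μ x).map (leval c) =
    bidiag n (k - μ - 1) (k - μ) 1 (fun r => c - x (k - 1 - r)) := by
  rw [map_K1]; simp [gam]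

lemma map_K2_eval (n μ : ℕ) (x : ℕ → ℂ) (c : ℂ) : (K2 n μ x).map (leval c) =
    bidiag n μ (μ + 1) 1 (fun r => c - x (μ - r)) := by
  rw [map_K2]; simp [gam]

lemma map_K1_coeff (n k μ : ℕ) (x : ℕ → ℂ) : (K1 n k μ x).map (lcoeff ℂ 1) =
    bidiag n (k - μ - 1) (k - μ) 0 (fun _ => 1) := by
  rw [map_K1]; simp [gam, coeff_one]

lemma map_K2_coeff (n μ : ℕ) (x : ℕ → ℂ) : (K2 n μ x).map (lcoeff ℂ 1) =
    bidiag n μ (μ + 1) 0 (fun _ => 1) := by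
  rw [map_K2]; simp [gam, coeff_one]

lemma eq_prod_smul_of_K1 (hμ : μ < k) (hlast : k - μ - 1 < k - μ) {c : ℂ}
    {u : Fin (k - μ) × Fin n → ℂ}
    (h : (K1 n k μ x).map (leval c) *ᵥ u = 0) :
    u = fun r => (∏ j ∈ Finset.Icc (μ + 1) (k - 1 - r.1), (c - x j)) *
      u (⟨k - μ - 1, hlast⟩, r.2) := by
  rw [map_K1_eval] at h
  refine eq_of_bidiag_one_mulVec (by omega)
    (G := fun r => ∏ j ∈ Finset.Icc (μ + 1) (k - 1 - r), (c - x j))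
    (fun r hr => prod_Icc_step (fun j => c - x j) (by omega)) ?_ h
  -- At the last block, `r = k - 1 - μ`, the product is empty.
  rw [Nat.sub_right_comm k μ 1]
  exact prod_Icc_last _ _ _

lemma eq_prod_smul_of_K2 (hlast : μ < μ + 1) {c : ℂ} {u : Fin (μ + 1) × Fin n → ℂ}
    (h : (K2 n μ x).map (leval c) *ᵥ u = 0) :
    u = fun r => (∏ j ∈ Finset.Icc 1 (μ - r.1), (c - x j)) * u (⟨μ, hlast⟩, r.2) := by
  rw [map_K2_eval] at h
  exact eq_of_bidiag_one_mulVec rfl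
    (G := fun r => ∏ j ∈ Finset.Icc 1 (μ - r), (c - x j))
    (fun r hr => prod_Icc_step (fun j => c - x j) (l := 0) (by omega))
    (prod_Icc_last _ 0 μ) h

lemma K1_mulVec_prod (hμ : μ < k) (c : ℂ) (b : Fin n → ℂ) :
    (K1 n k μ x).map (leval c) *ᵥ
      (fun r => (∏ j ∈ Finset.Icc (μ + 1) (k - 1 - r.1), (c - x j)) * b r.2) = 0 := by
  rw [map_K1_eval]
  exact bidiag_one_mulVec_eq_zero (by omega)
    (G := fun r => ∏ j ∈ Finset.Icc (μ + 1) (k - 1 - r), (c - x j))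
    (fun r hr => prod_Icc_step (fun j => c - x j) (by omega)) b

lemma K2_mulVec_prod (c : ℂ) (b : Fin n → ℂ) :
    (K2 n μ x).map (leval c) *ᵥ
      (fun r => (∏ j ∈ Finset.Icc 1 (μ - r.1), (c - x j)) * b r.2) = 0 := by
  rw [map_K2_eval]
  exact bidiag_one_mulVec_eq_zero rfl
    (G := fun r => ∏ j ∈ Finset.Icc 1 (μ - r), (c - x j))
    (fun r hr => prod_Icc_step (fun j => c - x j) (l := 0) (by omega)) b

/-! ### Recovery of the eigenvectors -/

lemma finite_right (hμ : μ < k) (hlast : k - μ - 1 < k - μ) {c : ℂ}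
    {z : (Fin (k - μ) × Fin n) ⊕ (Fin μ × Fin n) → ℂ}
    (hz : IsFiniteRightEigenvector (newtonLinearization k μ x P A B) c z) :
    IsFiniteRightEigenvector (newtonMatPoly k x P) c (block z ⟨k - μ - 1, hlast⟩) ∧
      ∀ i : Fin (k - μ), block z i = (∏ j ∈ Finset.Icc (μ + 1) (k - 1 - i), (c - x j)) •
        block z ⟨k - μ - 1, hlast⟩ := by
  obtain ⟨hz0, hz⟩ := hz
  -- Evaluation is recast as a linear functional, so that the entrywise lemmas apply.
  change (newtonLinearization k μ x P A B).map (leval c) *ᵥ z = 0 at hz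
  rw [map_newtonLinearization] at hz
  obtain ⟨h1, h2, h3⟩ := fromBlocks_mulVec_eq_zero (fun y hy => by
    rw [map_K2_eval] at hy
    exact eq_zero_of_bidiag_one_transpose rfl _ y hy) hz0 hz
  have hu := eq_prod_smul_of_K1 hμ hlast h1
  refine ⟨⟨fun h0 => h2 ?_, ?_⟩, fun i => ?_⟩
  · rw [hu]
    ext r
    exact mul_eq_zero_of_right _ (congrFun h0 r.2)
  · change (newtonMatPoly k x P).map (leval c) *ᵥ _ = 0
    -- Each test vector `b` extends to an element of the kernel of `K2` at `c`, whose pairing with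
    -- the body is known to vanish.
    refine dotProduct_eq_zero _ fun b => ?_
    rw [dotProduct_comm]
    have h4 := h3 _ (K2_mulVec_prod c b)
    rw [hu] at h4
    rw [← h4]
    exact (dotProduct_mulVec_scaled _ _ (fun r => ∏ j ∈ Finset.Icc 1 (μ - r), (c - x j))
      (fun r => ∏ j ∈ Finset.Icc (μ + 1) (k - 1 - r), (c - x j))
      (sum_body_eval hμ x P c) b _).symm
  · ext j
    exact congrFun hu (i, j)

lemma finite_left (hμ : μ < k) (hlast : μ < μ + 1) {c : ℂ}
    {w : (Fin (μ + 1) × Fin n) ⊕ (Fin (k - μ - 1) × Fin n) → ℂ}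
    (hw : IsFiniteLeftEigenvector (newtonLinearization k μ x P A B) c w) :
    IsFiniteLeftEigenvector (newtonMatPoly k x P) c (block w ⟨μ, hlast⟩) ∧
      ∀ i : Fin (μ + 1), block w i = (∏ j ∈ Finset.Icc 1 (μ - i), (c - x j)) •
        block w ⟨μ, hlast⟩ := by
  obtain ⟨hw0, hw⟩ := hw
  change w ᵥ* (newtonLinearization k μ x P A B).map (leval c) = 0 at hw
  rw [map_newtonLinearization] at hw
  obtain ⟨h1, h2, h3⟩ := vecMul_fromBlocks_eq_zero (fun y hy => by
    rw [map_K1_eval] at hy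
    exact eq_zero_of_bidiag_one_transpose (by omega) _ y hy) hw0 hw
  have hu := eq_prod_smul_of_K2 hlast h1
  refine ⟨⟨fun h0 => h2 ?_, ?_⟩, fun i => ?_⟩
  · rw [hu]
    ext r
    exact mul_eq_zero_of_right _ (congrFun h0 r.2)
  · change _ ᵥ* (newtonMatPoly k x P).map (leval c) = 0
    refine dotProduct_eq_zero _ fun b => ?_
    rw [← dotProduct_mulVec]
    have h4 := h3 _ (K1_mulVec_prod hμ c b)
    rw [hu] at h4
    rw [← h4]
    exact (dotProduct_mulVec_scaled _ _ (fun r => ∏ j ∈ Finset.Icc 1 (μ - r), (c - x j))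
      (fun r => ∏ j ∈ Finset.Icc (μ + 1) (k - 1 - r), (c - x j))
      (sum_body_eval hμ x P c) _ b).symm
  · ext j
    exact congrFun hu (i, j)

lemma infinite_right (hμ : μ < k) (hfirst : 0 < k - μ)
    {z : (Fin (k - μ) × Fin n) ⊕ (Fin μ × Fin n) → ℂ}
    (hz : IsFiniteRightEigenvector (rev 1 (newtonLinearization k μ x P A B)) 0 z) :
    IsFiniteRightEigenvector (rev k (newtonMatPoly k x P)) 0 (block z ⟨0, hfirst⟩) := by
  obtain ⟨hz0, hz⟩ := hz
  rw [map_eval_rev, map_newtonLinearization] at hz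
  obtain ⟨h1, h2, h3⟩ := fromBlocks_mulVec_eq_zero (fun y hy => by
    rw [map_K2_coeff] at hy
    exact eq_zero_of_bidiag_zero_transpose rfl y hy) hz0 hz
  rw [map_K1_coeff] at h1
  have hu := eq_of_bidiag_zero_mulVec (by omega) h1
  refine ⟨fun h0 => h2 ?_, ?_⟩
  · rw [hu]
    ext r
    exact mul_eq_zero_of_right _ (congrFun h0 r.2)
  · rw [map_eval_rev]
    refine dotProduct_eq_zero _ fun b => ?_
    rw [dotProduct_comm]
    rw [map_K2_coeff] at h3
    have h4 := h3 _ (bidiag_zero_mulVec_eq_zero rfl b)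
    rw [hu] at h4
    rw [← h4]
    exact (dotProduct_mulVec_scaled _ _ (fun r => if r = 0 then 1 else 0)
      (fun r => if r = 0 then 1 else 0) (sum_body_coeff hμ x P) b _).symm

lemma infinite_left (hμ : μ < k) (hfirst : 0 < μ + 1)
    {w : (Fin (μ + 1) × Fin n) ⊕ (Fin (k - μ - 1) × Fin n) → ℂ}
    (hw : IsFiniteLeftEigenvector (rev 1 (newtonLinearization k μ x P A B)) 0 w) :
    IsFiniteLeftEigenvector (rev k (newtonMatPoly k x P)) 0 (block w ⟨0, hfirst⟩) := by
  obtain ⟨hw0, hw⟩ := hw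
  rw [map_eval_rev, map_newtonLinearization] at hw
  obtain ⟨h1, h2, h3⟩ := vecMul_fromBlocks_eq_zero (fun y hy => by
    rw [map_K1_coeff] at hy
    -- The degree-one coefficient of `-1` is `0` and that of each `γ_j` is `1`, so the nodes drop
    -- out at infinity.
    exact eq_zero_of_bidiag_zero_transpose (by omega) y hy) hw0 hw
  rw [map_K2_coeff] at h1
  have hu := eq_of_bidiag_zero_mulVec rfl h1
  refine ⟨fun h0 => h2 ?_, ?_⟩
  · rw [hu]
    ext r
    exact mul_eq_zero_of_right _ (congrFun h0 r.2)
  · rw [map_eval_rev]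
    refine dotProduct_eq_zero _ fun b => ?_
    rw [← dotProduct_mulVec]
    rw [map_K1_coeff] at h3
    have h4 := h3 _ (bidiag_zero_mulVec_eq_zero (by omega) b)
    rw [hu] at h4
    rw [← h4]
    exact (dotProduct_mulVec_scaled _ _ (fun r => if r = 0 then 1 else 0)
      (fun r => if r = 0 then 1 else 0) (sum_body_coeff hμ x P) _ b).symm

lemma IsFiniteRightEigenvector.smul {ι κ : Type*} [Fintype κ] {Q : Matrix ι κ ℂ[X]} {c : ℂ}
    {v : κ → ℂ} (h : IsFiniteRightEigenvector Q c v) {t : ℂ} (ht : t ≠ 0) :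
    IsFiniteRightEigenvector Q c (t • v) :=
  ⟨smul_ne_zero ht h.1, by rw [mulVec_smul, h.2, smul_zero]⟩

lemma IsFiniteLeftEigenvector.smul {ι κ : Type*} [Fintype ι] {Q : Matrix ι κ ℂ[X]} {c : ℂ}
    {w : ι → ℂ} (h : IsFiniteLeftEigenvector Q c w) {t : ℂ} (ht : t ≠ 0) :
    IsFiniteLeftEigenvector Q c (t • w) :=
  ⟨smul_ne_zero ht h.1, by rw [smul_vecMul, h.2, smul_zero]⟩

end NewtonLin

theorem mainTheorem8 (n k μ : ℕ) (hμ : μ < k) (x : ℕ → ℂ)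
    (P : ℕ → Matrix (Fin n) (Fin n) ℂ)
    (hreg : NewtonLin.IsRegular (NewtonLin.newtonMatPoly k x P))
    (A : Matrix (Fin (μ + 1) × Fin n) (Fin (k - μ - 1) × Fin n) ℂ)
    (B : Matrix (Fin μ × Fin n) (Fin (k - μ) × Fin n) ℂ)
    (lam : OnePoint ℂ)
    (hlam : NewtonLin.IsEigenvalue k (NewtonLin.newtonMatPoly k x P) lam) :
    -- right eigenvectors
    (∀ z : (Fin (k - μ) × Fin n) ⊕ (Fin μ × Fin n) → ℂ,
      NewtonLin.IsRightEigenvector 1 (NewtonLin.newtonLinearization k μ x P A B) lam z →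
        (∀ c : ℂ, lam = (c : OnePoint ℂ) →
          NewtonLin.IsRightEigenvector k (NewtonLin.newtonMatPoly k x P) lam
            (NewtonLin.block z ⟨k - μ - 1, by omega⟩) ∧
          ((∀ j ∈ Finset.Icc (μ + 1) (k - 1), c ≠ x j) →
            ∀ i : Fin (k - μ),
              NewtonLin.IsRightEigenvector k (NewtonLin.newtonMatPoly k x P) lam
                (NewtonLin.block z i))) ∧
        (lam = OnePoint.infty →
          NewtonLin.IsRightEigenvector k (NewtonLin.newtonMatPoly k x P) lam
            (NewtonLin.block z ⟨0, by omega⟩))) ∧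
    -- left eigenvectors
    (∀ w : (Fin (μ + 1) × Fin n) ⊕ (Fin (k - μ - 1) × Fin n) → ℂ,
      NewtonLin.IsLeftEigenvector 1 (NewtonLin.newtonLinearization k μ x P A B) lam w →
        (∀ c : ℂ, lam = (c : OnePoint ℂ) →
          NewtonLin.IsLeftEigenvector k (NewtonLin.newtonMatPoly k x P) lam
            (NewtonLin.block w ⟨μ, by omega⟩) ∧
          ((∀ j ∈ Finset.Icc 1 μ, c ≠ x j) →
            ∀ i : Fin (μ + 1),
              NewtonLin.IsLeftEigenvector k (NewtonLin.newtonMatPoly k x P) lam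
                (NewtonLin.block w i))) ∧
        (lam = OnePoint.infty →
          NewtonLin.IsLeftEigenvector k (NewtonLin.newtonMatPoly k x P) lam
            (NewtonLin.block w ⟨0, by omega⟩))) := by
  refine ⟨fun z hz => ⟨?_, ?_⟩, fun w hw => ⟨?_, ?_⟩⟩
  · rintro c rfl
    obtain ⟨h1, h2⟩ := NewtonLin.finite_right hμ _ hz
    refine ⟨h1, fun hc i => ?_⟩
    rw [h2 i]
    -- Block `i` is the last block times a product of factors `c - x j`, all nonzero away from the
    -- listed nodes.
    refine NewtonLin.IsFiniteRightEigenvector.smul h1 (Finset.prod_ne_zero_iff.mpr fun j hj => ?_)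
    rw [Finset.mem_Icc] at hj
    exact sub_ne_zero.mpr (hc j (Finset.mem_Icc.mpr ⟨hj.1, by omega⟩))
  · rintro rfl
    exact NewtonLin.infinite_right hμ _ hz
  · rintro c rfl
    obtain ⟨h1, h2⟩ := NewtonLin.finite_left hμ _ hw
    refine ⟨h1, fun hc i => ?_⟩
    rw [h2 i]
    refine NewtonLin.IsFiniteLeftEigenvector.smul h1 (Finset.prod_ne_zero_iff.mpr fun j hj => ?_)
    rw [Finset.mem_Icc] at hj
    exact sub_ne_zero.mpr (hc j (Finset.mem_Icc.mpr ⟨hj.1, by omega⟩))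
  · rintro rfl
    exact NewtonLin.infinite_left hμ _ hw
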